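/- Let $\mathcal M$ be a smooth (Hausdorff, second countable) $n$-dimensional manifold with (possibly empty) boundary, $n\ge 1$, with interior $M=\mathrm{int}(\mathcal M)$ and boundary $\partial\mathcal M$. A *spacetime-with-timelike-boundary* $(\mathcal M,\mathfrak g)$ is such an $\mathcal M$ together with a smooth Lorentzian metric $\mathfrak g$ of signature $(-,+,\dots,+)$ whose pullback to $\partial\mathcal M$ is again Lorentzian, and a time orientation (given by a continuous timelike vector field). Its *interior spacetime* is $(M,g)$ with $g=\mathfrak g|_M$ and the restricted time orientation. For a point $p$ of a spacetime-with-timelike-boundary (or of a spacetime, the case of empty boundary), $I^+(p)$ (resp. $I^-(p)$) denotes the set of points $q$ such that there is a piecewise smooth future directed timelike curve in that spacetime from $p$ to $q$ (resp. from $q$ to $p$). It is called *past reflecting* if for all points $p$ and $q$, $I^+(q)\subset I^+(p)$ implies $I^-(p)\subset I^-(q)$. Lemma. Let $(\mathcal M,\mathfrak g)$ be a spacetime-with-timelike-boundary. If $(\mathcal M,\mathfrak g)$ is past reflecting, then its interior spacetime $(M,g)$ is past reflecting. -/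

import Mathlib

open Set TopologicalSpace
open scoped Manifold ContDiff Topology

noncomputable section

/-- The bilinear form `B` restricted to the subspace `W` is a Lorentzian scalar product, i.e. it
has signature `(-, +, …, +)`: some vector of `W` is negative, and `B` is positive definite on its
`B`-orthogonal complement in `W`. (Symmetry of `B` is required separately.) -/
def IsLorentzianOn {V : Type*} [AddCommGroup V] [Module ℝ V] (B : V → V → ℝ)
    (W : Submodule ℝ V) : Prop :=
  ∃ v ∈ W, B v v < 0 ∧ ∀ w ∈ W, B v w = 0 → w ≠ 0 → 0 < B w w

/-- For a boundary point `x` of a manifold with boundary modelled on the half-space `0 ≤ y 0`, the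
tangent space of the boundary at `x`, as a subspace of the tangent space of the manifold: the
vectors whose `0`-th component in the preferred chart at `x` vanishes. -/
def boundaryTangentSpace (n : ℕ) [NeZero n] {M : Type*} [TopologicalSpace M]
    [ChartedSpace (EuclideanHalfSpace n) M] (x : M) : Submodule ℝ (TangentSpace (𝓡∂ n) x) :=
  LinearMap.ker ((EuclideanSpace.proj (0 : Fin n) : EuclideanSpace ℝ (Fin n) →L[ℝ] ℝ).comp
    (mfderiv (𝓡∂ n) 𝓘(ℝ, EuclideanSpace ℝ (Fin n)) (extChartAt (𝓡∂ n) x) x) :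
      TangentSpace (𝓡∂ n) x →L[ℝ] ℝ).toLinearMap

/-- A spacetime-with-timelike-boundary structure on the smooth `n`-manifold with (possibly empty)
boundary `M`: a smooth Lorentzian metric for which the metric induced on the boundary is
Lorentzian too, and a time orientation, given by a continuous timelike vector field. If the boundary
is empty, this is a spacetime in the ordinary sense. -/
structure SpacetimeWithTimelikeBoundary (n : ℕ) [NeZero n] (M : Type*) [TopologicalSpace M]
    [ChartedSpace (EuclideanHalfSpace n) M] [IsManifold (𝓡∂ n) ∞ M] where
  /-- the metric tensor -/
  metric : ∀ x : M, TangentSpace (𝓡∂ n) x →L[ℝ] TangentSpace (𝓡∂ n) x →L[ℝ] ℝ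
  symm : ∀ (x : M) (v w : TangentSpace (𝓡∂ n) x), metric x v w = metric x w v
  smooth : ContMDiff (𝓡∂ n)
    ((𝓡∂ n).prod 𝓘(ℝ, EuclideanSpace ℝ (Fin n) →L[ℝ] EuclideanSpace ℝ (Fin n) →L[ℝ] ℝ)) ∞
    (fun x : M ↦ Bundle.TotalSpace.mk'
      (EuclideanSpace ℝ (Fin n) →L[ℝ] EuclideanSpace ℝ (Fin n) →L[ℝ] ℝ)
      (E := fun x : M ↦ TangentSpace (𝓡∂ n) x →L[ℝ] TangentSpace (𝓡∂ n) x →L[ℝ] ℝ) x (metric x))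
  lorentzian : ∀ x : M, IsLorentzianOn (fun v w ↦ metric x v w) ⊤
  timelike_boundary : ∀ x ∈ (𝓡∂ n).boundary M,
    IsLorentzianOn (fun v w ↦ metric x v w) (boundaryTangentSpace n x)
  /-- a timelike vector field that defines the time orientation -/
  timeField : ∀ x : M, TangentSpace (𝓡∂ n) x
  timeField_continuous :
    Continuous (fun x : M ↦ (⟨x, timeField x⟩ : TangentBundle (𝓡∂ n) M))
  timeField_timelike : ∀ x : M, metric x (timeField x) (timeField x) < 0

/-- The interior of the manifold with boundary `M`, as an open subset. As such it carries Mathlib's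
structure of a manifold on an open subset. -/
def interiorOpens (n : ℕ) [NeZero n] (M : Type*) [TopologicalSpace M]
    [ChartedSpace (EuclideanHalfSpace n) M] [IsManifold (𝓡∂ n) ∞ M] : Opens M :=
  ⟨(𝓡∂ n).interior M, (𝓡∂ n).isOpen_interior (n := ∞) (by simp)⟩

section OpenSubset

variable {n : ℕ} [NeZero n] {M : Type*} [TopologicalSpace M]
  [ChartedSpace (EuclideanHalfSpace n) M] [IsManifold (𝓡∂ n) ∞ M]

theorem mfderiv_val_eq (U : Opens M) (x₀ x : U)
    (hx : x.1 ∈ (chartAt (EuclideanHalfSpace n) x₀.1).source) :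
    mfderiv (𝓡∂ n) 𝓘(ℝ, EuclideanSpace ℝ (Fin n)) (extChartAt (𝓡∂ n) x₀) x =
      (mfderiv (𝓡∂ n) 𝓘(ℝ, EuclideanSpace ℝ (Fin n)) (extChartAt (𝓡∂ n) x₀.1) x.1).comp
        (mfderiv (𝓡∂ n) (𝓡∂ n) (Subtype.val : U → M) x) := by
  have h : (extChartAt (𝓡∂ n) x₀ : U → EuclideanSpace ℝ (Fin n)) =
      extChartAt (𝓡∂ n) x₀.1 ∘ (Subtype.val : U → M) := by
    ext y
    simp [extChartAt, U.chartAt_eq, OpenPartialHomeomorph.subtypeRestr]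
  rw [h]
  have : IsManifold (𝓡∂ n) 1 M := IsManifold.of_le (n := ∞) (by simp)
  refine mfderiv_comp x (mdifferentiableAt_extChartAt hx) ?_
  exact (contMDiff_subtype_val (n := 1) x).mdifferentiableAt (by simp)

/-- The inclusion of an open subset has invertible differentials. -/
theorem isInvertible_mfderiv_val (U : Opens M) (x : U) :
    (mfderiv (𝓡∂ n) (𝓡∂ n) (Subtype.val : U → M) x).IsInvertible := by
  have : IsManifold (𝓡∂ n) 1 M := IsManifold.of_le (n := ∞) (by simp)
  have h := mfderiv_val_eq U x x (mem_chart_source (EuclideanHalfSpace n) x.1)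
  have h1 := mfderiv_extChartAt_self (I := 𝓡∂ n) (x := x)
  have h2 := mfderiv_extChartAt_self (I := 𝓡∂ n) (x := x.1)
  rw [h1, h2] at h
  have h3 : (mfderiv (𝓡∂ n) (𝓡∂ n) (Subtype.val : U → M) x) =
      ContinuousLinearMap.id ℝ (EuclideanSpace ℝ (Fin n)) := h.symm
  rw [h3]
  exact ⟨ContinuousLinearEquiv.refl ℝ _, rfl⟩

/-- The restriction to an open subset `U` of a field `g` of bilinear forms, i.e. its pullback under
the inclusion of `U`. -/
def restrictForm (U : Opens M)
    (g : ∀ x : M, TangentSpace (𝓡∂ n) x →L[ℝ] TangentSpace (𝓡∂ n) x →L[ℝ] ℝ) (x : U) :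
    TangentSpace (𝓡∂ n) x →L[ℝ] TangentSpace (𝓡∂ n) x →L[ℝ] ℝ :=
  ((mfderiv (𝓡∂ n) (𝓡∂ n) (Subtype.val : U → M) x).precomp ℝ).comp
    ((g x.1).comp (mfderiv (𝓡∂ n) (𝓡∂ n) (Subtype.val : U → M) x))

@[simp] theorem restrictForm_apply (U : Opens M)
    (g : ∀ x : M, TangentSpace (𝓡∂ n) x →L[ℝ] TangentSpace (𝓡∂ n) x →L[ℝ] ℝ) (x : U)
    (v w : TangentSpace (𝓡∂ n) x) :
    restrictForm U g x v w = g x.1 (mfderiv (𝓡∂ n) (𝓡∂ n) (Subtype.val : U → M) x v)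
      (mfderiv (𝓡∂ n) (𝓡∂ n) (Subtype.val : U → M) x w) := rfl

theorem contMDiff_restrictForm (U : Opens M)
    (g : ∀ x : M, TangentSpace (𝓡∂ n) x →L[ℝ] TangentSpace (𝓡∂ n) x →L[ℝ] ℝ)
    (hg : ContMDiff (𝓡∂ n)
      ((𝓡∂ n).prod 𝓘(ℝ, EuclideanSpace ℝ (Fin n) →L[ℝ] EuclideanSpace ℝ (Fin n) →L[ℝ] ℝ)) ∞
      (fun x : M ↦ Bundle.TotalSpace.mk'
        (EuclideanSpace ℝ (Fin n) →L[ℝ] EuclideanSpace ℝ (Fin n) →L[ℝ] ℝ)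
        (E := fun x : M ↦ TangentSpace (𝓡∂ n) x →L[ℝ] TangentSpace (𝓡∂ n) x →L[ℝ] ℝ) x (g x))) :
    ContMDiff (𝓡∂ n)
      ((𝓡∂ n).prod 𝓘(ℝ, EuclideanSpace ℝ (Fin n) →L[ℝ] EuclideanSpace ℝ (Fin n) →L[ℝ] ℝ)) ∞
      (fun x : U ↦ Bundle.TotalSpace.mk'
        (EuclideanSpace ℝ (Fin n) →L[ℝ] EuclideanSpace ℝ (Fin n) →L[ℝ] ℝ)
        (E := fun x : U ↦ TangentSpace (𝓡∂ n) x →L[ℝ] TangentSpace (𝓡∂ n) x →L[ℝ] ℝ) x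
        (restrictForm U g x)) := by
  have : IsManifold (𝓡∂ n) 1 M := IsManifold.of_le (n := ∞) (by simp)
  intro x₀
  rw [contMDiffAt_hom_bundle]
  refine ⟨contMDiff_id x₀, ?_⟩
  have h := ((contMDiffAt_hom_bundle _).1 (hg x₀.1)).2.comp x₀ (contMDiff_subtype_val x₀)
  refine h.congr_of_eventuallyEq ?_
  have hs : (Subtype.val : U → M) ⁻¹' (chartAt (EuclideanHalfSpace n) x₀.1).source ∈ 𝓝 x₀ :=
    continuous_subtype_val.continuousAt.preimage_mem_nhds
      ((chartAt (EuclideanHalfSpace n) x₀.1).open_source.mem_nhds (mem_chart_source _ x₀.1))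
  filter_upwards [hs] with x hx
  have hxU : x ∈ (chartAt (EuclideanHalfSpace n) x₀).source := by
    simpa [U.chartAt_eq, OpenPartialHomeomorph.subtypeRestr] using hx
  -- compatibility of the trivializations of the two tangent bundles
  have key : ∀ v : EuclideanSpace ℝ (Fin n),
      mfderiv (𝓡∂ n) (𝓡∂ n) (Subtype.val : U → M) x
        ((trivializationAt (EuclideanSpace ℝ (Fin n)) (TangentSpace (𝓡∂ n)) x₀).symm x v) =
      (trivializationAt (EuclideanSpace ℝ (Fin n)) (TangentSpace (𝓡∂ n)) x₀.1).symm x.1 v := by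
    intro v
    have hb : x ∈ (trivializationAt (EuclideanSpace ℝ (Fin n))
      (TangentSpace (𝓡∂ n)) x₀).baseSet := by simpa using hxU
    have hb' : x.1 ∈ (trivializationAt (EuclideanSpace ℝ (Fin n))
      (TangentSpace (𝓡∂ n)) x₀.1).baseSet := by simpa using hx
    have e := mfderiv_val_eq U x₀ x hx
    rw [← TangentBundle.continuousLinearMapAt_trivializationAt hx,
      ← TangentBundle.continuousLinearMapAt_trivializationAt hxU] at e
    have e2 := DFunLike.congr_fun e
      ((trivializationAt (EuclideanSpace ℝ (Fin n)) (TangentSpace (𝓡∂ n)) x₀).symmL ℝ x v)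
    have e3 := (Bundle.Trivialization.continuousLinearMapAt_symmL (R := ℝ) _ hb v).symm.trans e2
    have e4 := congrArg ((trivializationAt (EuclideanSpace ℝ (Fin n))
      (TangentSpace (𝓡∂ n)) x₀.1).symmL ℝ x.1) e3
    have e5 := (e4.trans
      (Bundle.Trivialization.symmL_continuousLinearMapAt (R := ℝ) _ hb' _)).symm
    rw [Bundle.Trivialization.symmL_apply _ hb, Bundle.Trivialization.symmL_apply _ hb'] at e5
    exact e5
  refine ContinuousLinearMap.ext fun v ↦ ContinuousLinearMap.ext fun w ↦ ?_
  have hb : x ∈ (trivializationAt (EuclideanSpace ℝ (Fin n))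
    (TangentSpace (𝓡∂ n)) x₀).baseSet := by simpa using hxU
  have hb' : x.1 ∈ (trivializationAt (EuclideanSpace ℝ (Fin n))
    (TangentSpace (𝓡∂ n)) x₀.1).baseSet := by simpa using hx
  simp only [Function.comp_def]
  erw [inCoordinates_apply_eq₂ (E₃ := fun _ : U ↦ ℝ) hb hb (by simp),
    inCoordinates_apply_eq₂ (E₃ := fun _ : M ↦ ℝ) hb' hb' (by simp)]
  rw [restrictForm_apply, key, key]
  simp

end OpenSubset

namespace SpacetimeWithTimelikeBoundary

variable {n : ℕ} [NeZero n] {M : Type*} [TopologicalSpace M]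
  [ChartedSpace (EuclideanHalfSpace n) M] [IsManifold (𝓡∂ n) ∞ M]

/-- The interior spacetime `(M, g)` of a spacetime-with-timelike-boundary: the interior of the
manifold, with the restrictions (pullbacks under the inclusion) of the metric and of the vector
field that defines the time orientation. -/
def interior (S : SpacetimeWithTimelikeBoundary n M) :
    SpacetimeWithTimelikeBoundary n (interiorOpens n M) where
  metric := restrictForm (interiorOpens n M) S.metric
  symm x v w := by simp only [restrictForm_apply]; exact S.symm _ _ _
  smooth := contMDiff_restrictForm (interiorOpens n M) S.metric S.smooth
  lorentzian x := by
    have hi := isInvertible_mfderiv_val (n := n) (interiorOpens n M) x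
    obtain ⟨v, -, hv, hv'⟩ := S.lorentzian x.1
    obtain ⟨v, rfl⟩ := hi.surjective v
    refine ⟨v, trivial, hv, fun w _ hw hw0 ↦ hv' _ trivial hw fun h ↦ hw0 ?_⟩
    exact hi.injective (h.trans (map_zero _).symm)
  timelike_boundary x hx := by
    rw [ModelWithCorners.boundary_open, ← (𝓡∂ n).compl_interior] at hx
    exact (hx x.2).elim
  timeField := VectorField.mpullback (𝓡∂ n) (𝓡∂ n)
    (Subtype.val : interiorOpens n M → M) S.timeField
  timeField_continuous := by
    have h : ContMDiff (𝓡∂ n) (𝓡∂ n).tangent 0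
        (fun x : M ↦ (⟨x, S.timeField x⟩ : TangentBundle (𝓡∂ n) M)) :=
      contMDiff_zero_iff.2 S.timeField_continuous
    have : IsManifold (𝓡∂ n) 1 M := IsManifold.of_le (n := ∞) (by simp)
    exact (ContMDiff.mpullback_vectorField (n := 1) h contMDiff_subtype_val
      (isInvertible_mfderiv_val (n := n) (interiorOpens n M)) (by simp)).continuous
  timeField_timelike x := by
    have hi := isInvertible_mfderiv_val (n := n) (interiorOpens n M) x
    have h := hi.self_apply_inverse (S.timeField x.1)
    simp only [restrictForm_apply, VectorField.mpullback_apply]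
    rw [h]
    exact S.timeField_timelike x.1

/-- A tangent vector is timelike and future directed. -/
def IsFutureTimelike (S : SpacetimeWithTimelikeBoundary n M) {x : M}
    (v : TangentSpace (𝓡∂ n) x) : Prop :=
  S.metric x v v < 0 ∧ S.metric x v (S.timeField x) < 0

/-- There is a smooth future directed timelike curve, defined on `[0, 1]` (with one-sided
derivatives at the end points), from `p` to `q`. -/
def SmoothTimelikeCurve (S : SpacetimeWithTimelikeBoundary n M) (p q : M) : Prop :=
  ∃ γ : ℝ → M, ContMDiffOn 𝓘(ℝ, ℝ) (𝓡∂ n) ∞ γ (Icc 0 1) ∧ γ 0 = p ∧ γ 1 = q ∧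
    ∀ t ∈ Icc (0 : ℝ) 1,
      S.IsFutureTimelike (mfderivWithin 𝓘(ℝ, ℝ) (𝓡∂ n) γ (Icc 0 1) t (1 : ℝ))

/-- The chronology relation `p ≪ q`: there is a piecewise smooth future directed timelike curve from
`p` to `q`, i.e. a finite (nonempty) concatenation of smooth future directed timelike curves. -/
def Chron (S : SpacetimeWithTimelikeBoundary n M) : M → M → Prop :=
  Relation.TransGen S.SmoothTimelikeCurve

/-- The chronological future `I⁺(p)`. -/
def chronFuture (S : SpacetimeWithTimelikeBoundary n M) (p : M) : Set M := {q | S.Chron p q}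

/-- The chronological past `I⁻(p)`. -/
def chronPast (S : SpacetimeWithTimelikeBoundary n M) (p : M) : Set M := {q | S.Chron q p}

/-- Past reflectivity. -/
def PastReflecting (S : SpacetimeWithTimelikeBoundary n M) : Prop :=
  ∀ p q : M, S.chronFuture q ⊆ S.chronFuture p → S.chronPast p ⊆ S.chronPast q

end SpacetimeWithTimelikeBoundary

end

/-! The chronology relation of the interior is the restriction of that of the whole manifold
(`interior_chron_iff`), and any `q ≪ x` factors as `q ≪ m ≪ x` with `m` interior
(`Chron.exists_mem_interior`). Granting this, let `I⁺(q) ⊆ I⁺(p)` in the interior. If `q ≪ x` in the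
whole manifold, then `q ≪ m` in the interior, so `p ≪ m ≪ x`. The inclusion thus holds in the whole
manifold, past reflectivity applies there, and its conclusion restricts to the interior.

A timelike curve may touch the boundary, so it has to be pushed inside. Being future timelike is an
open condition, hence in a chart a short segment whose direction is nearly that of the curve is a
timelike curve (`exists_timelike_segment`). The half-space and its interior are convex, so such a
segment stays in the manifold, and in the interior if both ends are interior. Nearby points of the
curve are therefore related robustly under perturbation of both ends (`StablyChron`). Since the
interior is dense, the intermediate points of a chain of segments can be moved into it. -/

namespace SpacetimeWithTimelikeBoundary

variable {n : ℕ} [NeZero n] {M : Type*} [TopologicalSpace M]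
  [ChartedSpace (EuclideanHalfSpace n) M] [IsManifold (𝓡∂ n) ∞ M]

/-! ### Openness of the set of future timelike vectors -/

/-- The metric evaluated at continuous vector fields along the projection of the tangent bundle. -/
theorem continuous_metric_apply (S : SpacetimeWithTimelikeBoundary n M)
    {v w : ∀ m : TangentBundle (𝓡∂ n) M, TangentSpace (𝓡∂ n) m.proj}
    (hv : Continuous fun m : TangentBundle (𝓡∂ n) M ↦ (⟨m.proj, v m⟩ : TangentBundle (𝓡∂ n) M))
    (hw : Continuous fun m : TangentBundle (𝓡∂ n) M ↦ (⟨m.proj, w m⟩ : TangentBundle (𝓡∂ n) M)) :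
    Continuous fun m : TangentBundle (𝓡∂ n) M ↦ S.metric m.proj (v m) (w m) := by
  have : IsManifold (𝓡∂ n) 1 M := IsManifold.of_le (n := ∞) (by simp)
  have hg := (S.smooth.of_le (m := 0) (by simp)).comp
    (Bundle.contMDiff_proj (n := 0) (F := EuclideanSpace ℝ (Fin n)) (IB := 𝓡∂ n)
      (TangentSpace (𝓡∂ n) : M → Type _))
  have hv' : ContMDiff (𝓡∂ n).tangent (𝓡∂ n).tangent 0
    (fun m : TangentBundle (𝓡∂ n) M ↦ (⟨m.proj, v m⟩ : TangentBundle (𝓡∂ n) M)) :=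
    contMDiff_zero_iff.2 hv
  have hw' : ContMDiff (𝓡∂ n).tangent (𝓡∂ n).tangent 0
    (fun m : TangentBundle (𝓡∂ n) M ↦ (⟨m.proj, w m⟩ : TangentBundle (𝓡∂ n) M)) :=
    contMDiff_zero_iff.2 hw
  have h := ContMDiff.clm_bundle_apply₂ (F₁ := EuclideanSpace ℝ (Fin n))
    (F₂ := EuclideanSpace ℝ (Fin n)) (F₃ := ℝ)
    (E₁ := fun x : M ↦ TangentSpace (𝓡∂ n) x) (E₂ := fun x : M ↦ TangentSpace (𝓡∂ n) x)
    (E₃ := fun _ : M ↦ ℝ) (b := fun m : TangentBundle (𝓡∂ n) M ↦ m.proj)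
    hg hv' hw'
  refine continuous_iff_continuousAt.2 fun m ↦ ?_
  have hm := (h m).contMDiffWithinAt (s := univ)
  simp only [Bundle.contMDiffWithinAt_totalSpace] at hm
  exact continuousWithinAt_univ _ _ |>.1 hm.2.continuousWithinAt

theorem isOpen_isFutureTimelike (S : SpacetimeWithTimelikeBoundary n M) :
    IsOpen {m : TangentBundle (𝓡∂ n) M | S.IsFutureTimelike m.2} := by
  have h1 := S.continuous_metric_apply (v := fun m ↦ m.2) (w := fun m ↦ m.2)
    continuous_id continuous_id
  have h2 := S.continuous_metric_apply (v := fun m ↦ m.2) (w := fun m ↦ S.timeField m.proj)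
    continuous_id (S.timeField_continuous.comp (FiberBundle.continuous_proj _ _))
  exact (isOpen_lt h1 continuous_const).inter (isOpen_lt h2 continuous_const)

theorem IsFutureTimelike.smul {S : SpacetimeWithTimelikeBoundary n M} {x : M}
    {v : TangentSpace (𝓡∂ n) x} (hv : S.IsFutureTimelike v) {c : ℝ} (hc : 0 < c) :
    S.IsFutureTimelike (c • v) := by
  constructor
  · simp only [map_smul, smul_apply, smul_eq_mul]
    exact mul_neg_of_pos_of_neg hc (mul_neg_of_pos_of_neg hc hv.1)
  · simp only [map_smul, smul_apply, smul_eq_mul]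
    exact mul_neg_of_pos_of_neg hc hv.2

end SpacetimeWithTimelikeBoundary

/-! ### Timelike curves of the interior and of the whole manifold -/

/-- A map into an open subset is smooth if and only if it is so as a map into the manifold. -/
theorem contMDiffOn_val_comp_iff {n : ℕ} [NeZero n] {M : Type*} [TopologicalSpace M]
    [ChartedSpace (EuclideanHalfSpace n) M] (U : Opens M) {f : ℝ → U} {s : Set ℝ} :
    ContMDiffOn 𝓘(ℝ, ℝ) (𝓡∂ n) ∞ (Subtype.val ∘ f) s ↔ ContMDiffOn 𝓘(ℝ, ℝ) (𝓡∂ n) ∞ f s := by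
  refine ⟨fun h t ht ↦ ?_, fun h ↦ contMDiff_subtype_val.comp_contMDiffOn h⟩
  have h1 := contMDiffWithinAt_iff_target.1 (h t ht)
  refine contMDiffWithinAt_iff_target.2
    ⟨Topology.IsInducing.subtypeVal.continuousWithinAt_iff.2 h1.1, ?_⟩
  have e : (extChartAt (𝓡∂ n) (f t) : U → EuclideanSpace ℝ (Fin n)) =
      extChartAt (𝓡∂ n) (f t).1 ∘ (Subtype.val : U → M) := by
    ext y
    simp [extChartAt, U.chartAt_eq, OpenPartialHomeomorph.subtypeRestr]
  rw [e]
  exact h1.2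

namespace SpacetimeWithTimelikeBoundary

variable {n : ℕ} [NeZero n] {M : Type*} [TopologicalSpace M]
  [ChartedSpace (EuclideanHalfSpace n) M] [IsManifold (𝓡∂ n) ∞ M]

theorem interior_isFutureTimelike_iff (S : SpacetimeWithTimelikeBoundary n M)
    {x : interiorOpens n M} (v : TangentSpace (𝓡∂ n) x) :
    S.interior.IsFutureTimelike v ↔
      S.IsFutureTimelike (mfderiv (𝓡∂ n) (𝓡∂ n) (Subtype.val : interiorOpens n M → M) x v) := by
  have hi := isInvertible_mfderiv_val (n := n) (interiorOpens n M) x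
  have h := hi.self_apply_inverse (S.timeField x.1)
  simp only [IsFutureTimelike, interior, restrictForm_apply, VectorField.mpullback_apply]
  rw [h]

/-- A curve in the interior is smooth timelike there if and only if it is so in the manifold with
boundary. -/
theorem isFutureTimelike_val_comp_iff (S : SpacetimeWithTimelikeBoundary n M)
    {γ : ℝ → interiorOpens n M} (hγ : ContMDiffOn 𝓘(ℝ, ℝ) (𝓡∂ n) ∞ γ (Icc 0 1)) {t : ℝ}
    (ht : t ∈ Icc (0 : ℝ) 1) :
    S.IsFutureTimelike
        (mfderivWithin 𝓘(ℝ, ℝ) (𝓡∂ n) (Subtype.val ∘ γ) (Icc 0 1) t (1 : ℝ)) ↔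
      S.interior.IsFutureTimelike (mfderivWithin 𝓘(ℝ, ℝ) (𝓡∂ n) γ (Icc 0 1) t (1 : ℝ)) := by
  have : IsManifold (𝓡∂ n) 1 M := IsManifold.of_le (n := ∞) (by simp)
  rw [interior_isFutureTimelike_iff, mfderiv_comp_mfderivWithin t
    ((contMDiff_subtype_val (n := 1) (γ t)).mdifferentiableAt (by simp))
    ((hγ t ht).mdifferentiableWithinAt (by simp))
    ((uniqueDiffOn_Icc zero_lt_one) t ht).uniqueMDiffWithinAt]
  rfl

theorem SmoothTimelikeCurve.of_interior {S : SpacetimeWithTimelikeBoundary n M}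
    {p q : interiorOpens n M} (h : S.interior.SmoothTimelikeCurve p q) :
    S.SmoothTimelikeCurve p.1 q.1 := by
  obtain ⟨γ, hγ, rfl, rfl, h⟩ := h
  exact ⟨Subtype.val ∘ γ, (contMDiffOn_val_comp_iff _).2 hγ, rfl, rfl,
    fun t ht ↦ (S.isFutureTimelike_val_comp_iff hγ ht).2 (h t ht)⟩

theorem Chron.of_interior {S : SpacetimeWithTimelikeBoundary n M}
    {p q : interiorOpens n M} (h : S.interior.Chron p q) : S.Chron p.1 q.1 :=
  Relation.TransGen.lift Subtype.val (fun _ _ h ↦ SmoothTimelikeCurve.of_interior h) _ _ h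

/-- A smooth timelike curve that stays in the interior is a smooth timelike curve there. -/
theorem smoothTimelikeCurve_interior (S : SpacetimeWithTimelikeBoundary n M)
    {p q : interiorOpens n M} {γ : ℝ → M} (hγ : ContMDiffOn 𝓘(ℝ, ℝ) (𝓡∂ n) ∞ γ (Icc 0 1))
    (h0 : γ 0 = p.1) (h1 : γ 1 = q.1)
    (h : ∀ t ∈ Icc (0 : ℝ) 1,
      S.IsFutureTimelike (mfderivWithin 𝓘(ℝ, ℝ) (𝓡∂ n) γ (Icc 0 1) t (1 : ℝ)))
    (hint : ∀ t ∈ Icc (0 : ℝ) 1, γ t ∈ interiorOpens n M) :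
    S.interior.SmoothTimelikeCurve p q := by
  classical
  -- The value `p` is a dummy: only `t ∈ [0, 1]` matters, where `γ t` is interior.
  set c : ℝ → interiorOpens n M := fun t ↦ if h : γ t ∈ interiorOpens n M then ⟨γ t, h⟩ else p
  have hc : ∀ t ∈ Icc (0 : ℝ) 1, (Subtype.val ∘ c) t = γ t := fun t ht ↦ by
    simp [c, hint t ht]
  have hs : ContMDiffOn 𝓘(ℝ, ℝ) (𝓡∂ n) ∞ c (Icc 0 1) :=
    (contMDiffOn_val_comp_iff _).1 (hγ.congr hc)
  refine ⟨c, hs, Subtype.ext ((hc 0 (by simp)).trans h0), Subtype.ext ((hc 1 (by simp)).trans h1),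
    fun t ht ↦ (S.isFutureTimelike_val_comp_iff hs ht).1 ?_⟩
  have e := mfderivWithin_congr (I := 𝓘(ℝ, ℝ)) (I' := 𝓡∂ n) hc (hc t ht)
  -- The two velocities lie in tangent spaces at base points that are only propositionally equal;
  -- varying point and vector together permits the substitution.
  have key : ∀ (x : M) (v : EuclideanSpace ℝ (Fin n)), x = γ t →
      v = (mfderivWithin 𝓘(ℝ, ℝ) (𝓡∂ n) γ (Icc 0 1) t (1 : ℝ) : EuclideanSpace ℝ (Fin n)) →
      S.IsFutureTimelike (x := x) v := by
    rintro x v rfl rfl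
    exact h t ht
  exact key _ _ (hc t ht) (congrArg (fun L : ℝ →L[ℝ] EuclideanSpace ℝ (Fin n) ↦ L 1) e)

end SpacetimeWithTimelikeBoundary

/-! ### Half-space charts: convexity and density of the interior -/

theorem convex_range_euclideanHalfSpace (n : ℕ) [NeZero n] : Convex ℝ (range (𝓡∂ n)) := by
  rw [range_modelWithCornersEuclideanHalfSpace]
  exact convex_halfSpace_ge (f := fun y : EuclideanSpace ℝ (Fin n) ↦ y 0)
    ⟨fun _ _ ↦ rfl, fun _ _ ↦ rfl⟩ 0

section

variable {n : ℕ} [NeZero n] {M : Type*} [TopologicalSpace M]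
  [ChartedSpace (EuclideanHalfSpace n) M] [IsManifold (𝓡∂ n) ∞ M]

/-- Interior points are recognised in any preferred chart. -/
theorem mem_interiorOpens_iff {x₀ x : M} (hx : x ∈ (extChartAt (𝓡∂ n) x₀).source) :
    x ∈ interiorOpens n M ↔ extChartAt (𝓡∂ n) x₀ x ∈ interior (range (𝓡∂ n)) := by
  have h := ModelWithCorners.isInteriorPoint_iff_of_mem_atlas (I := 𝓡∂ n) (n := ∞) (x := x)
    (by simp) (chart_mem_atlas (EuclideanHalfSpace n) x₀) (by simpa using hx)
  refine h.trans ?_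
  refine ⟨fun h ↦ interior_mono ((chartAt (EuclideanHalfSpace n) x₀).extend_target_subset_range) h,
    fun h ↦ ?_⟩
  refine (chartAt (EuclideanHalfSpace n) x₀).mem_interior_extend_target ?_ h
  have hx' : x ∈ (chartAt (EuclideanHalfSpace n) x₀).source := by simpa using hx
  simpa using (chartAt (EuclideanHalfSpace n) x₀).map_source hx'

/-- Each point of the half-space is a limit of points of its interior, which the inverse chart
carries to interior points converging to `x`. -/
theorem dense_interiorOpens : Dense (interiorOpens n M : Set M) := by
  intro x
  have hx := mem_extChartAt_target (I := 𝓡∂ n) x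
  have h1 := mem_closure_iff_frequently.1 <|
    (𝓡∂ n).range_subset_closure_interior (extChartAt_target_subset_range (I := 𝓡∂ n) x hx)
  have h2 := eventually_nhdsWithin_iff.1 (extChartAt_target_mem_nhdsWithin (I := 𝓡∂ n) x)
  have h3 := (continuousAt_extChartAt_symm (I := 𝓡∂ n) x).tendsto
  rw [extChartAt_to_inv] at h3
  refine mem_closure_iff_frequently.2 (h3.frequently ((h1.and_eventually h2).mono ?_))
  rintro y ⟨hy, hy'⟩
  have hy' := hy' (interior_subset hy)
  refine (mem_interiorOpens_iff ((extChartAt (𝓡∂ n) x).map_target hy')).2 ?_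
  rwa [(extChartAt (𝓡∂ n) x).right_inv hy']

end

/-! ### Timelike coordinate segments -/

namespace SpacetimeWithTimelikeBoundary

variable {n : ℕ} [NeZero n] {M : Type*} [TopologicalSpace M]
  [ChartedSpace (EuclideanHalfSpace n) M] [IsManifold (𝓡∂ n) ∞ M]

/-- Near `x₀`, vectors whose coordinates in the preferred chart at `x₀` are close to those of a
future directed timelike vector at `x₀` are future directed timelike. -/
theorem exists_isFutureTimelike_of_near (S : SpacetimeWithTimelikeBoundary n M) (x₀ : M)
    {v : EuclideanSpace ℝ (Fin n)} (hv : S.IsFutureTimelike (x := x₀) v) :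
    ∃ δ > (0 : ℝ), ∀ y ∈ (extChartAt (𝓡∂ n) x₀).target, ∀ w : EuclideanSpace ℝ (Fin n),
      dist y (extChartAt (𝓡∂ n) x₀ x₀) < δ → dist w v < δ →
      S.IsFutureTimelike (mfderivWithin 𝓘(ℝ, EuclideanSpace ℝ (Fin n)) (𝓡∂ n)
        (extChartAt (𝓡∂ n) x₀).symm (extChartAt (𝓡∂ n) x₀).target y w) := by
  have : IsManifold (𝓡∂ n) 1 M := IsManifold.of_le (n := ∞) (by simp)
  set φ := extChartAt (𝓡∂ n) x₀
  have hc := (contMDiffOn_extChartAt_symm (I := 𝓡∂ n) (n := ∞) x₀).continuousOn_tangentMapWithin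
    (by simp) (uniqueDiffOn_extChartAt_target x₀).uniqueMDiffOn
  have hi : Continuous (fun z : EuclideanSpace ℝ (Fin n) × EuclideanSpace ℝ (Fin n) ↦
      (⟨z.1, z.2⟩ : TangentBundle 𝓘(ℝ, EuclideanSpace ℝ (Fin n)) (EuclideanSpace ℝ (Fin n)))) :=
    (tangentBundleModelSpaceHomeomorph 𝓘(ℝ, EuclideanSpace ℝ (Fin n))).symm.continuous
  have hc' := hc.comp
    (s := {z : EuclideanSpace ℝ (Fin n) × EuclideanSpace ℝ (Fin n) | z.1 ∈ φ.target})
    hi.continuousOn (fun z hz ↦ hz)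
  have hx : φ x₀ ∈ φ.target := mem_extChartAt_target x₀
  -- The differential of the inverse chart at `φ x₀` is the identity in the trivialization at `x₀`,
  -- so `hv` is the required condition at `(φ x₀, v)`.
  have e := (mfderivWithin_congr_set (I := 𝓘(ℝ, EuclideanSpace ℝ (Fin n))) (I' := 𝓡∂ n)
      (f := φ.symm) (extChartAt_target_eventuallyEq (I := 𝓡∂ n) (x := x₀))).trans
      (mfderivWithin_range_extChartAt_symm (I := 𝓡∂ n) (x := x₀))
  have key : ∀ (x : M) (w : EuclideanSpace ℝ (Fin n)), x = x₀ → w = v →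
      S.IsFutureTimelike (x := x) w := by
    rintro x w rfl rfl
    exact hv
  have hv' : S.IsFutureTimelike (mfderivWithin 𝓘(ℝ, EuclideanSpace ℝ (Fin n)) (𝓡∂ n)
        φ.symm φ.target (φ x₀) v) :=
    key _ _ (extChartAt_to_inv x₀)
      (congrArg (fun L : EuclideanSpace ℝ (Fin n) →L[ℝ] EuclideanSpace ℝ (Fin n) ↦ L v) e)
  have hm := (hc' (φ x₀, v) hx).preimage_mem_nhdsWithin (S.isOpen_isFutureTimelike.mem_nhds hv')
  obtain ⟨δ, hδ, h⟩ := Metric.mem_nhdsWithin_iff.1 hm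
  refine ⟨δ, hδ, fun y hy w h1 h2 ↦ ?_⟩
  have hyw : (y, w) ∈ Metric.ball (φ x₀, v) δ := max_lt h1 h2
  exact h ⟨hyw, hy⟩

/-- Near `x₀`, segments of the preferred chart at `x₀` whose direction is close to a future directed
timelike vector at `x₀` are timelike curves, and stay in the interior if both ends lie there. -/
theorem exists_timelike_segment (S : SpacetimeWithTimelikeBoundary n M) (x₀ : M)
    {v : EuclideanSpace ℝ (Fin n)} (hv : S.IsFutureTimelike (x := x₀) v) :
    ∃ δ > (0 : ℝ), ∀ a ∈ (extChartAt (𝓡∂ n) x₀).source, ∀ b ∈ (extChartAt (𝓡∂ n) x₀).source,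
      ∀ τ > (0 : ℝ),
      dist (extChartAt (𝓡∂ n) x₀ a) (extChartAt (𝓡∂ n) x₀ x₀) < δ →
      dist (extChartAt (𝓡∂ n) x₀ b) (extChartAt (𝓡∂ n) x₀ x₀) < δ →
      dist (τ⁻¹ • (extChartAt (𝓡∂ n) x₀ b - extChartAt (𝓡∂ n) x₀ a)) v < δ →
      S.SmoothTimelikeCurve a b ∧ ∀ (ha : a ∈ interiorOpens n M) (hb : b ∈ interiorOpens n M),
        S.interior.SmoothTimelikeCurve ⟨a, ha⟩ ⟨b, hb⟩ := by
  have : IsManifold (𝓡∂ n) 1 M := IsManifold.of_le (n := ∞) (by simp)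
  obtain ⟨δ₁, hδ₁, h₁⟩ := S.exists_isFutureTimelike_of_near x₀ hv
  obtain ⟨δ₂, hδ₂, h₂⟩ := Metric.mem_nhdsWithin_iff.1
    (extChartAt_target_mem_nhdsWithin (I := 𝓡∂ n) x₀)
  refine ⟨min δ₁ δ₂, lt_min hδ₁ hδ₂, fun a ha b hb τ hτ hda hdb hv ↦ ?_⟩
  set φ := extChartAt (𝓡∂ n) x₀
  set l : ℝ → EuclideanSpace ℝ (Fin n) := fun t ↦ φ a + t • (φ b - φ a) with hl
  have hseg : ∀ t ∈ Icc (0 : ℝ) 1, l t ∈ segment ℝ (φ a) (φ b) := fun t ht ↦ by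
    rw [segment_eq_image']
    exact ⟨t, ht, rfl⟩
  have hball : ∀ t ∈ Icc (0 : ℝ) 1, l t ∈ Metric.ball (φ x₀) (min δ₁ δ₂) := fun t ht ↦
    (convex_ball _ _).segment_subset hda hdb (hseg t ht)
  -- The part of the half-space inside the `δ₂`-ball lies in the chart target, and both the ball and
  -- the half-space are convex.
  have htar : ∀ t ∈ Icc (0 : ℝ) 1, l t ∈ φ.target := fun t ht ↦
    h₂ ⟨Metric.ball_subset_ball (min_le_right _ _) (hball t ht),
      (convex_range_euclideanHalfSpace n).segment_subset
        (extChartAt_target_subset_range x₀ (φ.map_source ha))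
        (extChartAt_target_subset_range x₀ (φ.map_source hb)) (hseg t ht)⟩
  have hld : ∀ t, HasDerivAt l (φ b - φ a) t := fun t ↦ by
    have := ((hasDerivAt_id t).smul_const (φ b - φ a)).const_add (φ a)
    rwa [one_smul] at this
  have hls : ContDiff ℝ ∞ l := by fun_prop
  have hs : ContMDiffOn 𝓘(ℝ, ℝ) (𝓡∂ n) ∞ (φ.symm ∘ l) (Icc 0 1) :=
    (contMDiffOn_extChartAt_symm x₀).comp hls.contMDiff.contMDiffOn htar
  have h0 : (φ.symm ∘ l) 0 = a := by simp [hl, φ.left_inv ha]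
  have h1 : (φ.symm ∘ l) 1 = b := by simp [hl, φ.left_inv hb]
  have ht : ∀ t ∈ Icc (0 : ℝ) 1, S.IsFutureTimelike
      (mfderivWithin 𝓘(ℝ, ℝ) (𝓡∂ n) (φ.symm ∘ l) (Icc 0 1) t (1 : ℝ)) := fun t ht ↦ by
    have hu := ((uniqueDiffOn_Icc zero_lt_one) t ht).uniqueMDiffWithinAt
    rw [mfderivWithin_comp t (((contMDiffOn_extChartAt_symm (n := ∞) x₀) (l t)
      (htar t ht)).mdifferentiableWithinAt (by simp))
      ((hls.contMDiff t).mdifferentiableAt (by simp)).mdifferentiableWithinAt htar hu]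
    have e : mfderivWithin 𝓘(ℝ, ℝ) 𝓘(ℝ, EuclideanSpace ℝ (Fin n)) l (Icc 0 1) t (1 : ℝ) =
        φ b - φ a := by
      rw [mfderivWithin_eq_fderivWithin]
      exact (hld t).hasDerivWithinAt.derivWithin (uniqueDiffOn_Icc zero_lt_one t ht)
    -- The velocity `φ b - φ a` is small; only its rescaling by `τ⁻¹` is near `v`, and positive
    -- scaling preserves future timelike vectors.
    have h2 := (h₁ (l t) (htar t ht) (τ⁻¹ • (φ b - φ a)) ((hball t ht).trans_le (min_le_left _ _))
      (hv.trans_le (min_le_left _ _))).smul hτ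
    have h3 : ∀ L : EuclideanSpace ℝ (Fin n) →L[ℝ] EuclideanSpace ℝ (Fin n),
        τ • L (τ⁻¹ • (φ b - φ a)) = L (φ b - φ a) := fun L ↦ by
      rw [← map_smul, smul_inv_smul₀ hτ.ne']
    have h4 : S.IsFutureTimelike (mfderivWithin 𝓘(ℝ, EuclideanSpace ℝ (Fin n)) (𝓡∂ n)
        φ.symm φ.target (l t) (φ b - φ a)) := by
      convert h2 using 1
      exact (h3 _).symm
    rw [← e] at h4
    exact h4
  refine ⟨⟨_, hs, h0, h1, ht⟩, fun ha' hb' ↦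
    S.smoothTimelikeCurve_interior hs h0 h1 ht fun t ht ↦ ?_⟩
  rw [Function.comp_apply, mem_interiorOpens_iff (φ.map_target (htar t ht)),
    φ.right_inv (htar t ht)]
  exact (convex_range_euclideanHalfSpace n).interior.segment_subset
    ((mem_interiorOpens_iff ha).1 ha') ((mem_interiorOpens_iff hb).1 hb') (hseg t ht)

end SpacetimeWithTimelikeBoundary

/-! ### Continuous induction on an interval -/

/-- A transitive relation on the reals that holds locally on both sides of each point of `[a, b]`
holds between `a` and `b`. -/
theorem rel_of_locally {r : ℝ → ℝ → Prop} (hr : ∀ x y z, r x y → r y z → r x z) {a b : ℝ}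
    (hab : a < b)
    (h : ∀ t ∈ Icc a b, ∀ᶠ s in 𝓝[Icc a b] t, (t < s → r t s) ∧ (s < t → r s t)) : r a b := by
  -- `r` need not be reflexive, so `a` is admitted separately.
  set A : Set ℝ := {t ∈ Icc a b | t = a ∨ r a t}
  have haA : a ∈ A := ⟨left_mem_Icc.2 hab.le, Or.inl rfl⟩
  have hbdd : BddAbove A := ⟨b, fun t ht ↦ ht.1.2⟩
  set σ := sSup A
  have hσ : σ ∈ Icc a b := ⟨le_csSup hbdd haA, csSup_le ⟨a, haA⟩ fun t ht ↦ ht.1.2⟩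
  obtain ⟨ε, hε, hball⟩ := Metric.mem_nhdsWithin_iff.1 (h σ hσ)
  have step : ∀ {x y}, (x = a ∨ r a x) → r x y → r a y := by
    rintro x y (rfl | hx) hxy
    exacts [hxy, hr _ _ _ hx hxy]
  have hσA : σ = a ∨ r a σ := by
    -- The supremum belongs to `A`: a member within `ε` of `σ` is either `σ` itself or related to
    -- it.
    obtain ⟨t, ht, hlt⟩ := exists_lt_of_lt_csSup ⟨a, haA⟩ (show σ - ε < sSup A by linarith)
    have htσ : t ≤ σ := le_csSup hbdd ht
    rcases htσ.eq_or_lt with rfl | htσ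
    · exact ht.2
    · refine Or.inr (step ht.2 ((hball ⟨?_, ht.1⟩).2 htσ))
      rw [Metric.mem_ball, Real.dist_eq, abs_lt]
      constructor <;> linarith
  rcases hσ.2.eq_or_lt with hb | hb
  · exact hb ▸ hσA.resolve_left (by rw [hb]; exact hab.ne')
  · exfalso
    -- If `σ < b`, a further local step gives a member of `A` beyond its supremum.
    set s := min b (σ + ε / 2)
    have hs : σ < s := lt_min hb (by linarith)
    have hs' : s ∈ Icc a b := ⟨hσ.1.trans hs.le, min_le_left _ _⟩
    have hsε : s ≤ σ + ε / 2 := min_le_right _ _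
    have : r a s := by
      refine step hσA ((hball ⟨?_, hs'⟩).1 hs)
      rw [Metric.mem_ball, Real.dist_eq, abs_lt]
      constructor <;> linarith
    exact hs.not_ge (le_csSup hbdd ⟨hs', Or.inr this⟩)

/-! ### Stable chronology and interior intermediate points -/

namespace SpacetimeWithTimelikeBoundary

variable {n : ℕ} [NeZero n] {M : Type*} [TopologicalSpace M]
  [ChartedSpace (EuclideanHalfSpace n) M] [IsManifold (𝓡∂ n) ∞ M]

/-- `a` and `b` are stably chronologically related: all points near `a` chronologically precede all
points near `b`, and do so within the interior if both are interior points. -/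
def StablyChron (S : SpacetimeWithTimelikeBoundary n M) (a b : M) : Prop :=
  ∀ᶠ z : M × M in 𝓝 (a, b), S.Chron z.1 z.2 ∧
    ∀ (h₁ : z.1 ∈ interiorOpens n M) (h₂ : z.2 ∈ interiorOpens n M),
      S.interior.Chron ⟨z.1, h₁⟩ ⟨z.2, h₂⟩

variable {S : SpacetimeWithTimelikeBoundary n M}

/-- If `b` is a boundary point, curves of the interior cannot be joined at `b`. Both relations
persist near `b`, so by density an interior point `m` near `b` replaces it, the same `m` for all
`z`. -/
theorem StablyChron.exists_mem_interior {a b c : M} (hab : S.StablyChron a b)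
    (hbc : S.StablyChron b c) : ∀ᶠ z : M × M in 𝓝 (a, c), ∃ m : interiorOpens n M,
      (S.Chron z.1 m ∧ ∀ h₁ : z.1 ∈ interiorOpens n M, S.interior.Chron ⟨z.1, h₁⟩ m) ∧
      (S.Chron m z.2 ∧ ∀ h₂ : z.2 ∈ interiorOpens n M, S.interior.Chron m ⟨z.2, h₂⟩) := by
  rw [StablyChron, nhds_prod_eq] at hab hbc
  obtain ⟨pa, ha, pb, hb, h₁⟩ := Filter.eventually_prod_iff.1 hab
  obtain ⟨pb', hb', pc, hc, h₂⟩ := Filter.eventually_prod_iff.1 hbc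
  obtain ⟨m, hm, hmb, hmb'⟩ :=
    ((mem_closure_iff_frequently.1 (dense_interiorOpens (n := n) b)).and_eventually
      (hb.and hb')).exists
  rw [nhds_prod_eq]
  filter_upwards [ha.prod_mk hc] with z hz
  have h3 := h₁ hz.1 hmb
  have h4 := h₂ hmb' hz.2
  exact ⟨⟨m, hm⟩, ⟨h3.1, fun h ↦ h3.2 h hm⟩, ⟨h4.1, fun h ↦ h4.2 hm h⟩⟩

theorem StablyChron.trans {a b c : M} (hab : S.StablyChron a b) (hbc : S.StablyChron b c) :
    S.StablyChron a c := by
  filter_upwards [hab.exists_mem_interior hbc] with z ⟨m, h1, h2⟩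
  exact ⟨h1.1.trans h2.1, fun h h' ↦ (h1.2 h).trans (h2.2 h')⟩

/-- Points close to each other on a smooth timelike curve are stably chronologically related. -/
theorem eventually_stablyChron {γ : ℝ → M}
    (hγ : ContMDiffOn 𝓘(ℝ, ℝ) (𝓡∂ n) ∞ γ (Icc 0 1)) {t : ℝ} (ht : t ∈ Icc (0 : ℝ) 1)
    (hft : S.IsFutureTimelike (mfderivWithin 𝓘(ℝ, ℝ) (𝓡∂ n) γ (Icc 0 1) t (1 : ℝ))) :
    ∀ᶠ s in 𝓝[Icc 0 1] t,
      (t < s → S.StablyChron (γ t) (γ s)) ∧ (s < t → S.StablyChron (γ s) (γ t)) := by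
  set φ := extChartAt (𝓡∂ n) (γ t)
  set v : EuclideanSpace ℝ (Fin n) := mfderivWithin 𝓘(ℝ, ℝ) (𝓡∂ n) γ (Icc 0 1) t (1 : ℝ)
  obtain ⟨δ, hδ, H⟩ := S.exists_timelike_segment (γ t) (v := v) hft
  -- The manifold derivative at `t` is by definition the derivative in the preferred charts, so `v`
  -- is the coordinate velocity.
  have hd : HasDerivWithinAt (φ ∘ γ) v (Icc 0 1) t := by
    have h := ((hγ t ht).mdifferentiableWithinAt (by simp)).hasMFDerivWithinAt.2
    simp only [writtenInExtChartAt, mfld_simps] at h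
    exact HasFDerivWithinAt.hasDerivWithinAt (F := EuclideanSpace ℝ (Fin n)) h
  have hsl := eventually_nhdsWithin_iff.1
    ((hasDerivWithinAt_iff_tendsto_slope.1 hd).eventually (Metric.ball_mem_nhds v hδ))
  have hball := hd.continuousWithinAt.eventually (Metric.ball_mem_nhds _ hδ)
  have hsrc := (hγ t ht).continuousWithinAt.eventually
    ((isOpen_extChartAt_source (I := 𝓡∂ n) (γ t)).mem_nhds (mem_extChartAt_source (γ t)))
  -- The hypotheses of `exists_timelike_segment` with `τ = y - x` are open in the two end points, so
  -- they survive perturbing `γ x` and `γ y`.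
  have main : ∀ x y : ℝ, x < y → γ x ∈ φ.source → γ y ∈ φ.source →
      dist (φ (γ x)) (φ (γ t)) < δ → dist (φ (γ y)) (φ (γ t)) < δ →
      dist (slope (φ ∘ γ) x y) v < δ → S.StablyChron (γ x) (γ y) := by
    intro x y hxy hx hy hx' hy' hv
    have cx : ContinuousAt (fun z : M × M ↦ φ z.1) (γ x, γ y) :=
      ContinuousAt.comp (x := (γ x, γ y)) (continuousAt_extChartAt' hx) continuousAt_fst
    have cy : ContinuousAt (fun z : M × M ↦ φ z.2) (γ x, γ y) :=
      ContinuousAt.comp (x := (γ x, γ y)) (continuousAt_extChartAt' hy) continuousAt_snd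
    have cs : ContinuousAt (fun z : M × M ↦ (y - x)⁻¹ • (φ z.2 - φ z.1)) (γ x, γ y) :=
      ContinuousAt.smul (f := fun _ ↦ (y - x)⁻¹) continuousAt_const (cy.sub cx)
    have ox := (isOpen_extChartAt_source (I := 𝓡∂ n) (γ t)).preimage (continuous_fst (Y := M))
    have oy := (isOpen_extChartAt_source (I := 𝓡∂ n) (γ t)).preimage (continuous_snd (X := M))
    filter_upwards [ox.mem_nhds (x := (γ x, γ y)) hx, oy.mem_nhds (x := (γ x, γ y)) hy,
      cx.eventually (Metric.isOpen_ball.mem_nhds hx'),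
      cy.eventually (Metric.isOpen_ball.mem_nhds hy'),
      cs.eventually (Metric.isOpen_ball.mem_nhds hv)] with z h1 h2 h3 h4 h5
    have h6 := H z.1 h1 z.2 h2 (y - x) (sub_pos.2 hxy) h3 h4 h5
    exact ⟨.single h6.1, fun h h' ↦ .single (h6.2 h h')⟩
  have hself : dist (φ (γ t)) (φ (γ t)) < δ := by simpa using hδ
  filter_upwards [eventually_nhdsWithin_iff.2 (hsl.mono fun s hs hs' ht ↦ hs ⟨hs', ht⟩), hball,
    hsrc] with s h1 h2 h3
  refine ⟨fun hts ↦ main t s hts (mem_extChartAt_source _) h3 hself h2 (h1 hts.ne'),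
    fun hst ↦ main s t hst h3 (mem_extChartAt_source _) h2 hself ?_⟩
  rw [slope_comm]
  exact h1 hst.ne

theorem stablyChron_of_lt {γ : ℝ → M} (hγ : ContMDiffOn 𝓘(ℝ, ℝ) (𝓡∂ n) ∞ γ (Icc 0 1))
    (hft : ∀ t ∈ Icc (0 : ℝ) 1,
      S.IsFutureTimelike (mfderivWithin 𝓘(ℝ, ℝ) (𝓡∂ n) γ (Icc 0 1) t (1 : ℝ)))
    {a b : ℝ} (ha : 0 ≤ a) (hab : a < b) (hb : b ≤ 1) : S.StablyChron (γ a) (γ b) :=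
  have hsub := Icc_subset_Icc ha hb
  rel_of_locally (r := fun x y ↦ S.StablyChron (γ x) (γ y)) (fun _ _ _ ↦ StablyChron.trans) hab
    fun t ht ↦ (eventually_stablyChron hγ (hsub ht) (hft t (hsub ht))).filter_mono
      (nhdsWithin_mono t hsub)

/-- The midpoint of a smooth timelike curve splits it into two stable relations; further curves of a
chain are absorbed into the second by transitivity. -/
theorem Chron.exists_stablyChron {p q : M} (h : S.Chron p q) :
    ∃ m, S.StablyChron p m ∧ S.StablyChron m q := by
  have key : ∀ {p q}, S.SmoothTimelikeCurve p q →
      ∃ m, S.StablyChron p m ∧ S.StablyChron m q := by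
    rintro p q ⟨γ, hγ, rfl, rfl, h⟩
    exact ⟨γ (1 / 2), stablyChron_of_lt hγ h (by norm_num) (by norm_num) (by norm_num),
      stablyChron_of_lt hγ h (by norm_num) (by norm_num) (by norm_num)⟩
  induction h with
  | single h => exact key h
  | tail _ h ih =>
    obtain ⟨m, h1, h2⟩ := ih
    obtain ⟨m', h3, h4⟩ := key h
    exact ⟨m, h1, h2.trans (h3.trans h4)⟩

/-- Between chronologically related points there is an interior point, and the relation to it holds
within the interior for those of the two points that are interior. -/
theorem Chron.exists_mem_interior {p q : M} (h : S.Chron p q) : ∃ m : interiorOpens n M,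
    (S.Chron p m ∧ ∀ h₁ : p ∈ interiorOpens n M, S.interior.Chron ⟨p, h₁⟩ m) ∧
    (S.Chron m q ∧ ∀ h₂ : q ∈ interiorOpens n M, S.interior.Chron m ⟨q, h₂⟩) := by
  obtain ⟨m, h1, h2⟩ := h.exists_stablyChron
  exact (h1.exists_mem_interior h2).self_of_nhds

/-- The chronology relation of the interior is the restriction of that of the manifold with
boundary. -/
theorem interior_chron_iff {p q : interiorOpens n M} : S.interior.Chron p q ↔ S.Chron p.1 q.1 := by
  refine ⟨Chron.of_interior, fun h ↦ ?_⟩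
  obtain ⟨m, h1, h2⟩ := h.exists_mem_interior
  exact (h1.2 p.2).trans (h2.2 q.2)

end SpacetimeWithTimelikeBoundary
theorem lemma3p6 (n : ℕ) [NeZero n] (M : Type*) [TopologicalSpace M] [T2Space M]
    [SecondCountableTopology M] [ChartedSpace (EuclideanHalfSpace n) M] [IsManifold (𝓡∂ n) ∞ M]
    (S : SpacetimeWithTimelikeBoundary n M) (hS : S.PastReflecting) :
    S.interior.PastReflecting := by
  intro p q hpq r hr
  refine SpacetimeWithTimelikeBoundary.interior_chron_iff.2 <| (hS p.1 q.1 (fun x hx ↦ ?_)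
    (SpacetimeWithTimelikeBoundary.Chron.of_interior hr))
  -- `x` may lie on the boundary, where `hpq` says nothing; it is applied to the interior point `m`
  -- between `q` and `x`.
  obtain ⟨m, h1, h2⟩ := SpacetimeWithTimelikeBoundary.Chron.exists_mem_interior hx
  exact (SpacetimeWithTimelikeBoundary.Chron.of_interior (hpq (h1.2 q.2))).trans h2.1
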